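/- Let $E=(E^0,E^1,s,r)$ be a finite directed graph ($E^0$ and $E^1$ finite sets, $s,r\colon E^1\to E^0$), and let $R$ be an associative, not necessarily commutative, ring with identity $1\neq 0$. The Leavitt path algebra $L_R(E)$ is the $R$-algebra generated by symbols $v$ ($v\in E^0$), $f$ and $f^*$ ($f\in E^1$), with the elements of $R$ commuting with these generators, subject to the relations (i) $vw=\delta_{v,w}v$ for all $v,w\in E^0$; (ii) $s(f)f=f\,r(f)=f$ and $r(f)f^*=f^*s(f)=f^*$ for all $f\in E^1$; (iii) $f^*g=\delta_{f,g}\,r(f)$ for all $f,g\in E^1$; (iv) $\sum_{f\in E^1,\ s(f)=v} ff^*=v$ for every $v\in E^0$ with $s^{-1}(v)\neq\emptyset$. It is a unital ring with identity $\sum_{v\in E^0}v$. A path of length $n\ge 1$ is a sequence of edges $\alpha=f_1\cdots f_n$ with $r(f_i)=s(f_{i+1})$, and one puts $\alpha^*=f_n^*\cdots f_1^*$; a vertex $v$ is a path of length $0$, with $v^*=v$. Equip $L_R(E)$ with its canonical $\mathbb{Z}$-grading, whose component $(L_R(E))_n$ consists of all finite sums $\sum_i a_i\alpha_i\beta_i^*$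 with $a_i\in R$ and $\alpha_i,\beta_i$ paths with the same range and $\operatorname{len}(\alpha_i)-\operatorname{len}(\beta_i)=n$, and let $\operatorname{Supp}(L_R(E))=\{n\in\mathbb{Z} : (L_R(E))_n\neq\{0\}\}$. A cycle is a path $f_1\cdots f_n$ with $n\ge1$, $s(f_1)=r(f_n)$ and $s(f_i)\neq s(f_1)$ for $2\le i\le n$; $E$ is acyclic if it has no cycle. If $R$ is left artinian, then the following assertions are equivalent: (a) $E$ is acyclic; (b) the ring $(L_R(E))_0$ is left artinian and $\operatorname{Supp}(L_R(E))$ is finite; (c) $L_R(E)$ is left artinian. If $R$ is right artinian, then the same equivalence holds with "left" replaced by "right" throughout. -/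

import Mathlib

/-- A directed graph `(E⁰, E¹, s, r)` with vertex set `V`, edge set `Ed`, source map `s` and
range map `r`. Loops and parallel edges are allowed. -/
structure DirectedGraph (V Ed : Type*) where
  /-- the source of an edge -/
  s : Ed → V
  /-- the range of an edge -/
  r : Ed → V

namespace DirectedGraph

variable {V Ed : Type*} (E : DirectedGraph V Ed)

/-- `E.IsPath u α w`: the list of edges `α = f₁ f₂ … fₙ` is a path with source `u` and range `w`,
i.e. consecutive edges satisfy `r(fᵢ) = s(fᵢ₊₁)`. The empty list, with `u = w`, is the path of
length zero at the vertex `u`. -/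
def IsPath : V → List Ed → V → Prop
  | u, [], w => u = w
  | u, f :: l, w => E.s f = u ∧ IsPath (E.r f) l w

/-- A cycle: a path `f₁ f₂ … fₙ` of positive length with `s(f₁) = r(fₙ)` and
`s(fᵢ) ≠ s(f₁)` for `2 ≤ i ≤ n`. -/
def IsCycle : List Ed → Prop
  | [] => False
  | f :: l => E.IsPath (E.s f) (f :: l) (E.s f) ∧ ∀ g ∈ l, E.s g ≠ E.s f

/-- A graph is acyclic if it has no cycles. -/
def IsAcyclic : Prop := ∀ l : List Ed, ¬ E.IsCycle l

variable {E}

theorem IsPath.append {u v w : V} {α β : List Ed} (hα : E.IsPath u α v) (hβ : E.IsPath v β w) :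
    E.IsPath u (α ++ β) w := by
  induction α generalizing u with
  | nil => obtain rfl : u = v := hα; exact hβ
  | cons f α ih => exact ⟨hα.1, ih hα.2⟩

end DirectedGraph

/-- The symbols that generate the Leavitt path algebra: the vertices `v`, the real edges `f` and
the ghost edges `f*`. -/
inductive LeavittGenerator (V Ed : Type*)
  | vertex (v : V)
  | edge (f : Ed)
  | ghost (f : Ed)

/-- The free unital `R`-ring on the generating symbols, whose elements are polynomials with
coefficients in `R` in the noncommuting symbols. The coefficients commute with the symbols
(but `R` itself need not be commutative). -/
abbrev FreeLeavitt (R V Ed : Type*) [Ring R] : Type _ :=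
  MonoidAlgebra R (FreeMonoid (LeavittGenerator V Ed))

namespace FreeLeavitt

variable (R : Type*) {V Ed : Type*} [Ring R]

/-- A vertex, as a noncommutative polynomial. -/
noncomputable def vertex (v : V) : FreeLeavitt R V Ed :=
  MonoidAlgebra.of R _ (FreeMonoid.of (.vertex v))

/-- A real edge, as a noncommutative polynomial. -/
noncomputable def edge (f : Ed) : FreeLeavitt R V Ed :=
  MonoidAlgebra.of R _ (FreeMonoid.of (.edge f))

/-- A ghost edge, as a noncommutative polynomial. -/
noncomputable def ghost (f : Ed) : FreeLeavitt R V Ed :=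
  MonoidAlgebra.of R _ (FreeMonoid.of (.ghost f))

/-- The defining relations of the Leavitt path algebra of a graph with finitely many vertices.
The last relation says that the identity is `∑ v`. The (a priori nonunital) `R`-algebra given by
the generators and the other relations has the identity `∑ v`, because each generator, multiplied
by `∑ v` on either side, is reproduced by the other relations; hence the
presentation as a unital ring with this last relation gives the same algebra. -/
inductive Rel [Fintype V] (E : DirectedGraph V Ed) :
    FreeLeavitt R V Ed → FreeLeavitt R V Ed → Prop
  | vertex_mul_self (v : V) : Rel E (vertex R v * vertex R v) (vertex R v)
  | vertex_mul_of_ne {v w : V} (h : v ≠ w) : Rel E (vertex R v * vertex R w) 0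
  | source_mul_edge (f : Ed) : Rel E (vertex R (E.s f) * edge R f) (edge R f)
  | edge_mul_range (f : Ed) : Rel E (edge R f * vertex R (E.r f)) (edge R f)
  | range_mul_ghost (f : Ed) : Rel E (vertex R (E.r f) * ghost R f) (ghost R f)
  | ghost_mul_source (f : Ed) : Rel E (ghost R f * vertex R (E.s f)) (ghost R f)
  | ghost_mul_edge_self (f : Ed) : Rel E (ghost R f * edge R f) (vertex R (E.r f))
  | ghost_mul_edge_of_ne {f g : Ed} (h : f ≠ g) : Rel E (ghost R f * edge R g) 0
  -- `S` is the set `s⁻¹(v)`, assumed to be finite and nonempty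
  | sum_edge_mul_ghost (v : V) (S : Finset Ed) (hS : ∀ f, f ∈ S ↔ E.s f = v) (hne : S.Nonempty) :
      Rel E (∑ f ∈ S, edge R f * ghost R f) (vertex R v)
  | sum_vertex : Rel E (∑ v : V, vertex R v) 1

end FreeLeavitt

/-- The Leavitt path algebra `L_R(E)` of a graph `E` with finitely many vertices, with coefficients
in a unital, not necessarily commutative, ring `R`. -/
def LeavittPathAlgebra (R : Type*) {V Ed : Type*} [Ring R] [Fintype V]
    (E : DirectedGraph V Ed) : Type _ :=
  RingQuot (FreeLeavitt.Rel R E)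

noncomputable instance (R : Type*) {V Ed : Type*} [Ring R] [Fintype V] (E : DirectedGraph V Ed) :
    Ring (LeavittPathAlgebra R E) :=
  inferInstanceAs (Ring (RingQuot (FreeLeavitt.Rel R E)))

namespace LeavittPathAlgebra

variable (R : Type*) {V Ed : Type*} [Ring R] [Fintype V] (E : DirectedGraph V Ed)

/-- The quotient map from noncommutative polynomials to `L_R(E)`. -/
noncomputable def mk : FreeLeavitt R V Ed →+* LeavittPathAlgebra R E :=
  RingQuot.mkRingHom (FreeLeavitt.Rel R E)

/-- The image of a coefficient in `L_R(E)`. -/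
noncomputable def coeff (a : R) : LeavittPathAlgebra R E :=
  mk R E (MonoidAlgebra.singleOneRingHom a)

/-- The image of a vertex in `L_R(E)`. -/
noncomputable def vertex (v : V) : LeavittPathAlgebra R E :=
  mk R E (FreeLeavitt.vertex R v)

/-- The image of a real edge in `L_R(E)`. -/
noncomputable def edge (f : Ed) : LeavittPathAlgebra R E :=
  mk R E (FreeLeavitt.edge R f)

/-- The image of a ghost edge in `L_R(E)`. -/
noncomputable def ghost (f : Ed) : LeavittPathAlgebra R E :=
  mk R E (FreeLeavitt.ghost R f)

/-- The real path `α = f₁ f₂ … fₙ` with source `u`, as an element of `L_R(E)`. The factor `u` is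
redundant for a path of positive length, and makes a path of length zero the vertex `u`. -/
noncomputable def path (u : V) (α : List Ed) : LeavittPathAlgebra R E :=
  vertex R E u * (α.map (edge R E)).prod

/-- The ghost path `β* = fₙ* … f₂* f₁*` of the path `β = f₁ f₂ … fₙ` with source `u`. -/
noncomputable def ghostPath (u : V) (β : List Ed) : LeavittPathAlgebra R E :=
  (β.reverse.map (ghost R E)).prod * vertex R E u

/-- The homogeneous component of degree `n` of the canonical `ℤ`-grading: all finite sums
`∑ aᵢ αᵢ βᵢ*` with `aᵢ ∈ R`, where `αᵢ` and `βᵢ` are paths with the same range and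
`len αᵢ - len βᵢ = n`. -/
noncomputable def component (n : ℤ) : AddSubgroup (LeavittPathAlgebra R E) :=
  AddSubgroup.closure {x | ∃ (a : R) (u u' w : V) (α β : List Ed),
    E.IsPath u α w ∧ E.IsPath u' β w ∧ (α.length : ℤ) - β.length = n ∧
    x = coeff R E a * (path R E u α * ghostPath R E u' β)}

/-- The support of the canonical `ℤ`-grading. -/
def support : Set ℤ := {n | component R E n ≠ ⊥}

variable {R E}

theorem mk_rel {x y : FreeLeavitt R V Ed} (h : FreeLeavitt.Rel R E x y) :
    mk R E x = mk R E y :=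
  RingQuot.mkRingHom_rel h

theorem vertex_mul_self (v : V) : vertex R E v * vertex R E v = vertex R E v := by
  simpa [vertex] using mk_rel (FreeLeavitt.Rel.vertex_mul_self (R := R) (E := E) v)

theorem vertex_mul_of_ne {v w : V} (h : v ≠ w) : vertex R E v * vertex R E w = 0 := by
  simpa [vertex] using mk_rel (FreeLeavitt.Rel.vertex_mul_of_ne (R := R) (E := E) h)

theorem source_mul_edge (f : Ed) : vertex R E (E.s f) * edge R E f = edge R E f := by
  simpa [vertex, edge] using
    mk_rel (FreeLeavitt.Rel.source_mul_edge (R := R) (E := E) f)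

theorem edge_mul_range (f : Ed) : edge R E f * vertex R E (E.r f) = edge R E f := by
  simpa [vertex, edge] using
    mk_rel (FreeLeavitt.Rel.edge_mul_range (R := R) (E := E) f)

theorem range_mul_ghost (f : Ed) : vertex R E (E.r f) * ghost R E f = ghost R E f := by
  simpa [vertex, ghost] using
    mk_rel (FreeLeavitt.Rel.range_mul_ghost (R := R) (E := E) f)

theorem ghost_mul_source (f : Ed) : ghost R E f * vertex R E (E.s f) = ghost R E f := by
  simpa [vertex, ghost] using
    mk_rel (FreeLeavitt.Rel.ghost_mul_source (R := R) (E := E) f)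

theorem ghost_mul_edge_self (f : Ed) : ghost R E f * edge R E f = vertex R E (E.r f) := by
  simpa [vertex, edge, ghost] using
    mk_rel (FreeLeavitt.Rel.ghost_mul_edge_self (R := R) (E := E) f)

theorem ghost_mul_edge_of_ne {f g : Ed} (h : f ≠ g) : ghost R E f * edge R E g = 0 := by
  simpa [edge, ghost] using
    mk_rel (FreeLeavitt.Rel.ghost_mul_edge_of_ne (R := R) (E := E) h)

theorem sum_vertex : ∑ v : V, vertex R E v = 1 := by
  simpa [vertex] using mk_rel (FreeLeavitt.Rel.sum_vertex (R := R) (E := E))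

theorem coeff_mul (a b : R) : coeff R E (a * b) = coeff R E a * coeff R E b := by
  rw [coeff, map_mul, map_mul]; rfl

theorem coeff_one : coeff R E (1 : R) = 1 := by
  rw [coeff, map_one, map_one]

/-- The coefficients commute with the generators, and so with all products of generators. -/
theorem coeff_comm_of (a : R) (m : FreeMonoid (LeavittGenerator V Ed)) :
    Commute (coeff R E a)
      (mk R E (MonoidAlgebra.of R _ m)) := by
  have h : (MonoidAlgebra.singleOneRingHom a : FreeLeavitt R V Ed) * MonoidAlgebra.of R _ m
      = MonoidAlgebra.of R _ m * MonoidAlgebra.singleOneRingHom a := by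
    simp [MonoidAlgebra.single_mul_single]
  simp only [coeff, Commute, SemiconjBy, ← map_mul, h]

theorem coeff_comm_path (a : R) (u : V) (α : List Ed) :
    Commute (coeff R E a) (path R E u α) := by
  refine Commute.mul_right (coeff_comm_of a _) (Commute.list_prod_right _ _ ?_)
  intro x hx
  obtain ⟨f, -, rfl⟩ := List.mem_map.1 hx
  exact coeff_comm_of a _

theorem coeff_comm_ghostPath (a : R) (u : V) (α : List Ed) :
    Commute (coeff R E a) (ghostPath R E u α) := by
  refine Commute.mul_right (Commute.list_prod_right _ _ ?_) (coeff_comm_of a _)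
  intro x hx
  obtain ⟨f, -, rfl⟩ := List.mem_map.1 hx
  exact coeff_comm_of a _

theorem path_nil (u : V) : path R E u [] = vertex R E u := by simp [path]

theorem ghostPath_nil (u : V) : ghostPath R E u [] = vertex R E u := by simp [ghostPath]

theorem path_cons (f : Ed) (α : List Ed) :
    path R E (E.s f) (f :: α) = edge R E f * path R E (E.r f) α := by
  simp only [path, List.map_cons, List.prod_cons, ← mul_assoc, source_mul_edge, edge_mul_range]

theorem ghostPath_cons (f : Ed) (α : List Ed) :
    ghostPath R E (E.s f) (f :: α) = ghostPath R E (E.r f) α * ghost R E f := by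
  simp only [ghostPath, List.reverse_cons, List.map_append, List.prod_append, List.map_cons,
    List.map_nil, List.prod_singleton, mul_assoc, ghost_mul_source, range_mul_ghost]

theorem vertex_mul_path (u : V) (α : List Ed) :
    vertex R E u * path R E u α = path R E u α := by
  simp only [path, ← mul_assoc, vertex_mul_self]

theorem ghostPath_mul_vertex (u : V) (α : List Ed) :
    ghostPath R E u α * vertex R E u = ghostPath R E u α := by
  simp only [ghostPath, mul_assoc, vertex_mul_self]

theorem path_mul_path {u v : V} {α : List Ed} (h : E.IsPath u α v) (β : List Ed) :
    path R E u α * path R E v β = path R E u (α ++ β) := by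
  induction α generalizing u with
  | nil => obtain rfl : u = v := h; rw [path_nil, vertex_mul_path, List.nil_append]
  | cons f α ih =>
    obtain ⟨rfl, h⟩ := h
    rw [List.cons_append, path_cons, path_cons, mul_assoc, ih h]

theorem ghostPath_mul_ghostPath {u v : V} {α : List Ed} (h : E.IsPath u α v) (β : List Ed) :
    ghostPath R E v β * ghostPath R E u α = ghostPath R E u (α ++ β) := by
  induction α generalizing u with
  | nil => obtain rfl : u = v := h; rw [ghostPath_nil, ghostPath_mul_vertex, List.nil_append]
  | cons f α ih =>
    obtain ⟨rfl, h⟩ := h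
    rw [List.cons_append, ghostPath_cons, ghostPath_cons, ← mul_assoc, ih h]

/-- A product `β* γ` of a ghost path and a real path is zero, a real path or a ghost path. -/
theorem ghostPath_mul_path {u u' w w' : V} {β γ : List Ed} (hβ : E.IsPath u β w)
    (hγ : E.IsPath u' γ w') :
    ghostPath R E u β * path R E u' γ = 0 ∨
    (∃ δ : List Ed, E.IsPath w δ w' ∧ (δ.length : ℤ) = γ.length - β.length ∧
      ghostPath R E u β * path R E u' γ = path R E w δ) ∨
    (∃ δ : List Ed, E.IsPath w' δ w ∧ (δ.length : ℤ) = β.length - γ.length ∧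
      ghostPath R E u β * path R E u' γ = ghostPath R E w' δ) := by
  by_cases huu : u = u'
  swap
  · left
    rw [ghostPath, path, mul_assoc, ← mul_assoc (vertex R E u), vertex_mul_of_ne huu]
    simp
  subst huu
  induction β generalizing u γ with
  | nil =>
    obtain rfl : u = w := hβ
    right; left
    exact ⟨γ, hγ, by simp, by rw [ghostPath_nil, vertex_mul_path]⟩
  | cons f β ih =>
    cases γ with
    | nil =>
      obtain rfl : u = w' := hγ
      right; right
      exact ⟨f :: β, hβ, by simp, by rw [path_nil, ghostPath_mul_vertex]⟩
    | cons g γ =>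
      obtain ⟨hf, hβ⟩ := hβ
      obtain ⟨hg, hγ⟩ := hγ
      have key : ghostPath R E u (f :: β) * path R E u (g :: γ) =
          ghostPath R E (E.r f) β * (ghost R E f * edge R E g) * path R E (E.r g) γ := by
        conv_lhs => rw [← hf, ghostPath_cons, hf, ← hg, path_cons]
        simp only [mul_assoc]
      by_cases hfg : f = g
      · subst hfg
        rw [ghost_mul_edge_self, ghostPath_mul_vertex] at key
        rw [key]
        simpa using ih hβ hγ
      · left
        rw [key, ghost_mul_edge_of_ne hfg]
        simp

theorem component_mul_mem {m n : ℤ} {x y : LeavittPathAlgebra R E} (hx : x ∈ component R E m)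
    (hy : y ∈ component R E n) : x * y ∈ component R E (m + n) := by
  induction hx using AddSubgroup.closure_induction with
  | zero => simp
  | add a b _ _ ha hb => rw [add_mul]; exact add_mem ha hb
  | neg a _ ha => rw [neg_mul]; exact neg_mem ha
  | mem x hx =>
    induction hy using AddSubgroup.closure_induction with
    | zero => simp
    | add a b _ _ ha hb => rw [mul_add]; exact add_mem ha hb
    | neg a _ ha => rw [mul_neg]; exact neg_mem ha
    | mem y hy =>
      obtain ⟨a, u, u', w, α, β, hα, hβ, hm, rfl⟩ := hx
      obtain ⟨b, v, v', z, γ, δ, hγ, hδ, hn, rfl⟩ := hy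
      have h : coeff R E a * (path R E u α * ghostPath R E u' β) *
          (coeff R E b * (path R E v γ * ghostPath R E v' δ)) =
          coeff R E (a * b) *
            (path R E u α * (ghostPath R E u' β * path R E v γ) * ghostPath R E v' δ) := by
        have h1 := ((coeff_comm_path (E := E) b u α).mul_right
          (coeff_comm_ghostPath b u' β)).eq
        rw [mul_assoc, ← mul_assoc (path R E u α * _), ← h1, coeff_mul]
        simp only [mul_assoc]
      rw [h]
      rcases ghostPath_mul_path (R := R) hβ hγ with h0 | ⟨ε, hε, hl, h0⟩ | ⟨ε, hε, hl, h0⟩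
      · simp [h0]
      · rw [h0, path_mul_path hα]
        exact AddSubgroup.subset_closure ⟨a * b, u, v', z, α ++ ε, δ, hα.append hε, hδ,
          by rw [List.length_append]; push_cast; omega, rfl⟩
      · rw [h0, mul_assoc, ghostPath_mul_ghostPath hδ]
        exact AddSubgroup.subset_closure ⟨a * b, u, v', w, α, δ ++ ε, hα, hδ.append hε,
          by rw [List.length_append]; push_cast; omega, rfl⟩

theorem one_mem_component : (1 : LeavittPathAlgebra R E) ∈ component R E 0 := by
  rw [← sum_vertex]
  refine sum_mem fun v _ => AddSubgroup.subset_closure ⟨1, v, v, v, [], [], rfl, rfl, by simp, ?_⟩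
  rw [path_nil, ghostPath_nil, vertex_mul_self, coeff_one, one_mul]

variable (R E)

/-- The principal component `(L_R(E))_0` of the canonical `ℤ`-grading, as a ring. -/
noncomputable def principalComponent : Subring (LeavittPathAlgebra R E) where
  __ := component R E 0
  mul_mem' hx hy := by simpa using component_mul_mem hx hy
  one_mem' := one_mem_component

end LeavittPathAlgebra

/-! ### Closed paths and acyclicity. -/

namespace DirectedGraph

variable {V Ed : Type*} {E : DirectedGraph V Ed}

/-! In an acyclic graph no path repeats an edge, so path lengths are bounded by the number of edges.
Hence only finitely many degrees occur, and finitely many monomials `αβ*` span `L_R(E)` over `R`.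
Every subring containing the coefficients is an `R`-submodule of this finitely generated module,
hence artinian (`isArtinianRing_subring_of_finite`).

For the converses, a cycle gives a periodic infinite path `x`, and `L_R(E)` acts on the free module
with basis (infinite path, integer): edges are added or removed at the front, and the integer
records the degree. The ghost of each initial path of `x` sends one basis vector to another, so it
is nonzero and all degrees `-n` occur (`infinite_support_of_not_isAcyclic`).

Let `c` run through a period of `x`, of length `m`, let `p = 1 - c*`, and let `e` be the basis
vector `(x, 0)`. On `e`, `p` acts as `D = 1 - T`, where `T` lowers the degree by `m` and commutes
with the whole action. If the left ideals generated by the powers of `p` stabilize, then `pⁿ = z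
pⁿ⁺¹`, and applying this to `e` gives `Dⁿ e = Dⁿ (D (z e))`. As `D` is injective, `e` lies in its
range; but the sum of the coefficients vanishes on that range and is `1` on `e`. The right version
follows by the involution `L_R(E) → L_{Rᵒᵖ}(E)ᵒᵖ`. -/

theorem isPath_append_iff {u w : V} {α β : List Ed} :
    E.IsPath u (α ++ β) w ↔ ∃ v, E.IsPath u α v ∧ E.IsPath v β w := by
  induction α generalizing u with
  | nil => simp [IsPath]
  | cons f α ih => simp [IsPath, ih, and_assoc]

/-- Every closed path of positive length gives rise to a cycle. -/
theorem IsAcyclic.eq_nil_of_isPath (h : E.IsAcyclic) {u : V} {l : List Ed}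
    (hl : E.IsPath u l u) : l = [] := by
  induction hn : l.length using Nat.strong_induction_on generalizing l with
  | _ n ih =>
    cases l with
    | nil => rfl
    | cons f l =>
      exfalso
      obtain ⟨rfl, hl⟩ := hl
      refine h (f :: l) ⟨⟨rfl, hl⟩, fun g hg hgf => ?_⟩
      -- If a later edge `g` leaves the base vertex, the part before `g` is a shorter nonempty
      -- closed path.
      obtain ⟨l₁, l₂, rfl⟩ := List.append_of_mem hg
      obtain ⟨v, h₁, h₂, -⟩ := isPath_append_iff.1 hl
      obtain rfl : v = E.s f := h₂.symm.trans hgf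
      exact List.cons_ne_nil f l₁ (ih _ (by simp at hn ⊢; omega) (l := f :: l₁) ⟨rfl, h₁⟩ rfl)

/-- The stretch from one occurrence of an edge up to the next would be a closed path. -/
theorem IsAcyclic.nodup_of_isPath (h : E.IsAcyclic) {u w : V} {l : List Ed}
    (hl : E.IsPath u l w) : l.Nodup := by
  induction l generalizing u with
  | nil => exact List.nodup_nil
  | cons f l ih =>
    obtain ⟨rfl, hl⟩ := hl
    refine List.nodup_cons.2 ⟨fun hf => ?_, ih hl⟩
    obtain ⟨l₁, l₂, rfl⟩ := List.append_of_mem hf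
    obtain ⟨v, h₁, h₂, -⟩ := isPath_append_iff.1 hl
    subst h₂
    exact List.cons_ne_nil f l₁ (h.eq_nil_of_isPath (u := E.s f) (l := f :: l₁) ⟨rfl, h₁⟩)

theorem IsAcyclic.length_le (h : E.IsAcyclic) [Finite Ed] {u w : V} {l : List Ed}
    (hl : E.IsPath u l w) : l.length ≤ Nat.card Ed := by
  have := Fintype.ofFinite Ed
  rw [Nat.card_eq_fintype_card]
  exact (h.nodup_of_isPath hl).length_le_card

/-! ### Infinite paths. -/

variable (E) in
/-- An infinite path `f₀ f₁ f₂ …` of the graph `E`. -/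
def InfinitePath : Type _ := {x : ℕ → Ed // ∀ i, E.r (x i) = E.s (x (i + 1))}

namespace InfinitePath

/-- The source of an infinite path. -/
def source (x : E.InfinitePath) : V := E.s (x.1 0)

/-- The infinite path without its first edge. -/
def tail (x : E.InfinitePath) : E.InfinitePath := ⟨fun i => x.1 (i + 1), fun i => x.2 (i + 1)⟩

/-- The infinite path with an edge put in front of it. -/
def cons (f : Ed) (x : E.InfinitePath) (h : x.source = E.r f) : E.InfinitePath :=
  ⟨fun i => Nat.casesOn i f x.1, fun i => by
    cases i with
    | zero => exact h.symm
    | succ i => exact x.2 i⟩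

theorem source_tail (x : E.InfinitePath) : x.tail.source = E.r (x.1 0) := (x.2 0).symm

theorem tail_cons (f : Ed) (x : E.InfinitePath) (h : x.source = E.r f) :
    (x.cons f h).tail = x := rfl

theorem cons_tail (x : E.InfinitePath) : x.tail.cons (x.1 0) x.source_tail = x := by
  apply Subtype.ext
  funext i
  cases i <;> rfl

/-- The initial path of length `n`. -/
def take (x : E.InfinitePath) : ℕ → List Ed
  | 0 => []
  | n + 1 => x.1 0 :: x.tail.take n

theorem length_take (x : E.InfinitePath) (n : ℕ) : (x.take n).length = n := by
  induction n generalizing x with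
  | zero => rfl
  | succ n ih => simp [take, ih]

theorem isPath_take (x : E.InfinitePath) (n : ℕ) :
    E.IsPath x.source (x.take n) (tail^[n] x).source := by
  induction n generalizing x with
  | zero => rfl
  | succ n ih => exact ⟨rfl, by rw [← source_tail]; exact ih _⟩

theorem val_iterate_tail (x : E.InfinitePath) (n i : ℕ) : (tail^[n] x).1 i = x.1 (i + n) := by
  induction n generalizing x with
  | zero => rfl
  | succ n ih => rw [Function.iterate_succ_apply, ih]; simp [tail]; congr 1

end InfinitePath

/-- Serves to unroll a cycle periodically, where edges are looked up by index modulo the length. -/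
theorem isPath_iff_getElem {u w : V} {l : List Ed} (hl : l ≠ []) :
    E.IsPath u l w ↔ E.s (l.head hl) = u ∧ E.r (l.getLast hl) = w ∧
      ∀ i (hi : i + 1 < l.length), E.r l[i] = E.s l[i + 1] := by
  induction l generalizing u with
  | nil => exact absurd rfl hl
  | cons f l ih =>
    cases l with
    | nil => simp [IsPath]
    | cons g l =>
      rw [IsPath, ih (List.cons_ne_nil g l)]
      constructor
      · rintro ⟨h₁, h₂, h₃, h₄⟩
        refine ⟨h₁, h₃, fun i hi => ?_⟩
        cases i with
        | zero => exact h₂.symm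
        | succ i => exact h₄ i (by simpa using hi)
      · rintro ⟨h₁, h₂, h₃⟩
        exact ⟨h₁, (h₃ 0 (by simp)).symm, h₂, fun i hi => h₃ (i + 1) (by simpa using hi)⟩

/-- Going around a cycle for ever is a periodic infinite path. -/
theorem exists_periodic_infinitePath (h : ¬ E.IsAcyclic) :
    ∃ (x : E.InfinitePath) (n : ℕ), 0 < n ∧ InfinitePath.tail^[n] x = x := by
  simp only [IsAcyclic, not_forall, not_not] at h
  obtain ⟨l, hl⟩ := h
  cases l with
  | nil => exact hl.elim
  | cons f l =>
    obtain ⟨p, hpos, h₂, h₃⟩ : ∃ (p : List Ed) (hpos : 0 < p.length),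
        E.r (p[p.length - 1]) = E.s p[0] ∧
          ∀ i (hi : i + 1 < p.length), E.r p[i] = E.s p[i + 1] := by
      obtain ⟨-, h₂, h₃⟩ := (isPath_iff_getElem (List.cons_ne_nil f l)).1 hl.1
      exact ⟨f :: l, by simp, by rw [← List.getLast_eq_getElem]; exact h₂, h₃⟩
    refine ⟨⟨fun i => p.get ⟨i % p.length, Nat.mod_lt _ hpos⟩, fun i => ?_⟩, p.length, hpos, ?_⟩
    -- Either the next edge is in the same lap, or the last edge is followed by the first, where
    -- closedness enters.
    · rcases Nat.lt_or_ge (i % p.length + 1) p.length with hi | hi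
      · have : (i + 1) % p.length = i % p.length + 1 := by
          rw [Nat.add_mod, Nat.mod_eq_of_lt (by omega : 1 < p.length), Nat.mod_eq_of_lt hi]
        simp only [this]
        exact h₃ _ hi
      · have hlt := Nat.mod_lt i hpos
        have h₄ : (i + 1) % p.length = 0 := by
          rw [← Nat.mod_add_mod, show i % p.length + 1 = p.length by omega, Nat.mod_self]
        have h₅ : i % p.length = p.length - 1 := by omega
        simp only [h₄, h₅]
        exact h₂
    · apply Subtype.ext
      funext i
      refine (InfinitePath.val_iterate_tail _ _ _).trans ?_
      simp

end DirectedGraph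

/-! ### Induction on generators, the universal property and the sum of the components. -/

namespace LeavittPathAlgebra

variable {R V Ed : Type*} [Ring R] [Fintype V] {E : DirectedGraph V Ed}

variable (R E) in
/-- The embedding of the coefficients, as a ring homomorphism. -/
noncomputable def coeffHom : R →+* LeavittPathAlgebra R E :=
  (mk R E).comp MonoidAlgebra.singleOneRingHom

theorem mk_surjective : Function.Surjective (mk R E) := RingQuot.mkRingHom_surjective _

theorem induction {p : LeavittPathAlgebra R E → Prop} (hc : ∀ a, p (coeff R E a))
    (hv : ∀ v, p (vertex R E v)) (he : ∀ f, p (edge R E f)) (hg : ∀ f, p (ghost R E f))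
    (hadd : ∀ x y, p x → p y → p (x + y)) (hmul : ∀ x y, p x → p y → p (x * y))
    (x : LeavittPathAlgebra R E) : p x := by
  obtain ⟨x, rfl⟩ := mk_surjective x
  induction x using MonoidAlgebra.induction_on with
  | of m =>
    induction m using FreeMonoid.inductionOn' with
    | one => rw [map_one, map_one, ← coeff_one]; exact hc 1
    | of_mul g m ih =>
      rw [map_mul, map_mul]
      refine hmul _ _ ?_ ih
      cases g with
      | vertex v => exact hv v
      | edge f => exact he f
      | ghost f => exact hg f
  | add x y hx hy => rw [map_add]; exact hadd _ _ hx hy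
  | smul r x hx =>
    have : r • x = MonoidAlgebra.singleOneRingHom r * x := by
      ext m; exact (MonoidAlgebra.coeff_single_one_mul x r m).symm
    rw [this, map_mul]
    exact hmul _ _ (hc r) hx

variable (R E) in
/-- The images of the generators of `L_R(E)` in a ring `S`, subject to the defining relations. -/
structure Family (S : Type*) [Ring S] where
  /-- the image of the coefficients -/
  coeff : R →+* S
  /-- the images of the vertices -/
  vertex : V → S
  /-- the images of the real edges -/
  edge : Ed → S
  /-- the images of the ghost edges -/
  ghost : Ed → S
  commute_vertex (a : R) (v : V) : Commute (coeff a) (vertex v)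
  commute_edge (a : R) (f : Ed) : Commute (coeff a) (edge f)
  commute_ghost (a : R) (f : Ed) : Commute (coeff a) (ghost f)
  vertex_mul_self (v : V) : vertex v * vertex v = vertex v
  vertex_mul_of_ne {v w : V} (h : v ≠ w) : vertex v * vertex w = 0
  source_mul_edge (f : Ed) : vertex (E.s f) * edge f = edge f
  edge_mul_range (f : Ed) : edge f * vertex (E.r f) = edge f
  range_mul_ghost (f : Ed) : vertex (E.r f) * ghost f = ghost f
  ghost_mul_source (f : Ed) : ghost f * vertex (E.s f) = ghost f
  ghost_mul_edge_self (f : Ed) : ghost f * edge f = vertex (E.r f)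
  ghost_mul_edge_of_ne {f g : Ed} (h : f ≠ g) : ghost f * edge g = 0
  sum_edge_mul_ghost (v : V) (S : Finset Ed) (hS : ∀ f, f ∈ S ↔ E.s f = v) (hne : S.Nonempty) :
    ∑ f ∈ S, edge f * ghost f = vertex v
  sum_vertex : ∑ v, vertex v = 1

namespace Family

variable {S : Type*} [Ring S] (F : Family R E S)

/-- The image of a generator. -/
def generator : LeavittGenerator V Ed → S
  | .vertex v => F.vertex v
  | .edge f => F.edge f
  | .ghost f => F.ghost f

/-- The homomorphism on noncommutative polynomials. -/
noncomputable def freeLift : FreeLeavitt R V Ed →+* S :=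
  -- The image of `R` need not be central in `S`; it is enough that coefficients commute with the
  -- images of words.
  MonoidAlgebra.liftNCRingHom F.coeff (FreeMonoid.lift F.generator) fun a m => by
    induction m using FreeMonoid.inductionOn' with
    | one => rw [map_one]; exact Commute.one_right _
    | of_mul g m ih =>
      rw [map_mul, FreeMonoid.lift_eval_of]
      refine Commute.mul_right ?_ ih
      cases g with
      | vertex v => exact F.commute_vertex a v
      | edge f => exact F.commute_edge a f
      | ghost f => exact F.commute_ghost a f

theorem freeLift_of (g : LeavittGenerator V Ed) :
    F.freeLift (MonoidAlgebra.of R _ (FreeMonoid.of g)) = F.generator g := by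
  rw [freeLift, MonoidAlgebra.of_apply, MonoidAlgebra.liftNCRingHom_single]
  simp

theorem freeLift_vertex (v : V) : F.freeLift (FreeLeavitt.vertex R v) = F.vertex v :=
  F.freeLift_of _

theorem freeLift_edge (f : Ed) : F.freeLift (FreeLeavitt.edge R f) = F.edge f :=
  F.freeLift_of _

theorem freeLift_ghost (f : Ed) : F.freeLift (FreeLeavitt.ghost R f) = F.ghost f :=
  F.freeLift_of _

/-- The universal property of the Leavitt path algebra. -/
noncomputable def lift : LeavittPathAlgebra R E →+* S :=
  RingQuot.lift ⟨F.freeLift, fun x y h => by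
    induction h <;> simp only [map_mul, map_sum, map_zero, map_one, freeLift_vertex,
      freeLift_edge, freeLift_ghost]
    case vertex_mul_self v => exact F.vertex_mul_self v
    case vertex_mul_of_ne h => exact F.vertex_mul_of_ne h
    case source_mul_edge f => exact F.source_mul_edge f
    case edge_mul_range f => exact F.edge_mul_range f
    case range_mul_ghost f => exact F.range_mul_ghost f
    case ghost_mul_source f => exact F.ghost_mul_source f
    case ghost_mul_edge_self f => exact F.ghost_mul_edge_self f
    case ghost_mul_edge_of_ne h => exact F.ghost_mul_edge_of_ne h
    case sum_edge_mul_ghost v S hS hne => exact F.sum_edge_mul_ghost v S hS hne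
    case sum_vertex => exact F.sum_vertex⟩

theorem lift_mk (x : FreeLeavitt R V Ed) : F.lift (LeavittPathAlgebra.mk R E x) = F.freeLift x :=
  RingQuot.lift_mkRingHom_apply _ _ _

theorem lift_coeff (a : R) : F.lift (LeavittPathAlgebra.coeff R E a) = F.coeff a := by
  rw [LeavittPathAlgebra.coeff, lift_mk, freeLift]
  refine (MonoidAlgebra.liftNCRingHom_single _ _ _ 1 a).trans ?_
  simp

theorem lift_vertex (v : V) : F.lift (LeavittPathAlgebra.vertex R E v) = F.vertex v :=
  (F.lift_mk _).trans (F.freeLift_vertex v)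

theorem lift_edge (f : Ed) : F.lift (LeavittPathAlgebra.edge R E f) = F.edge f :=
  (F.lift_mk _).trans (F.freeLift_edge f)

theorem lift_ghost (f : Ed) : F.lift (LeavittPathAlgebra.ghost R E f) = F.ghost f :=
  (F.lift_mk _).trans (F.freeLift_ghost f)

end Family

theorem sum_edge_mul_ghost (v : V) (S : Finset Ed) (hS : ∀ f, f ∈ S ↔ E.s f = v)
    (hne : S.Nonempty) : ∑ f ∈ S, edge R E f * ghost R E f = vertex R E v := by
  simpa [vertex, edge, ghost] using
    mk_rel (FreeLeavitt.Rel.sum_edge_mul_ghost (R := R) (E := E) v S hS hne)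

/-- Degrees add under multiplication, so the sum of the components is closed under products; it
remains to find the coefficients and generators in it. -/
theorem mem_iSup_component (x : LeavittPathAlgebra R E) : x ∈ ⨆ n, component R E n := by
  have hmem {n : ℤ} {x : LeavittPathAlgebra R E} (hx : x ∈ component R E n) :
      x ∈ ⨆ n, component R E n := (le_iSup (component R E) n) hx
  have hmul (x y) (hx : x ∈ ⨆ n, component R E n) (hy : y ∈ ⨆ n, component R E n) :
      x * y ∈ ⨆ n, component R E n := by
    refine AddSubgroup.iSup_induction _ (C := fun x => x * y ∈ ⨆ n, component R E n) hx
      (fun m x hx => ?_) (by simp) fun a b ha hb => by rw [add_mul]; exact add_mem ha hb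
    exact AddSubgroup.iSup_induction _ (C := fun y => x * y ∈ ⨆ n, component R E n) hy
      (fun n y hy => hmem (component_mul_mem hx hy)) (by simp)
      fun a b ha hb => by rw [mul_add]; exact add_mem ha hb
  have hgen (u u' w : V) (α β : List Ed) (hα : E.IsPath u α w) (hβ : E.IsPath u' β w) :
      path R E u α * ghostPath R E u' β ∈ ⨆ n, component R E n :=
    hmem (AddSubgroup.subset_closure ⟨1, u, u', w, α, β, hα, hβ, rfl, by simp [coeff_one]⟩)
  induction x using LeavittPathAlgebra.induction with
  | hc a =>
    rw [← mul_one (coeff R E a), ← sum_vertex, Finset.mul_sum]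
    refine sum_mem fun v _ => hmem (n := 0) (AddSubgroup.subset_closure
      ⟨a, v, v, v, [], [], rfl, rfl, by simp, ?_⟩)
    rw [path_nil, ghostPath_nil, vertex_mul_self]
  | hv v =>
    have := hgen v v v [] [] rfl rfl
    rwa [path_nil, ghostPath_nil, vertex_mul_self] at this
  | he f =>
    have := hgen (E.s f) (E.r f) (E.r f) [f] [] ⟨rfl, rfl⟩ rfl
    rwa [path_cons, ghostPath_nil, path_nil, edge_mul_range, edge_mul_range] at this
  | hg f =>
    have := hgen (E.r f) (E.s f) (E.r f) [] [f] rfl ⟨rfl, rfl⟩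
    rwa [ghostPath_cons, ghostPath_nil, path_nil, range_mul_ghost, range_mul_ghost] at this
  | hadd x y hx hy => exact add_mem hx hy
  | hmul x y hx hy => exact hmul x y hx hy

/-! ### Finiteness over the coefficients for acyclic graphs. -/

/-- The Leavitt path algebra of an acyclic finite graph is finitely generated as a module over
its coefficients. -/
theorem exists_finite_generators [Finite Ed] (h : E.IsAcyclic) :
    ∃ t : Set (LeavittPathAlgebra R E), t.Finite ∧ (∀ a, ∀ y ∈ t, Commute (coeff R E a) y) ∧
      ∀ x, x ∈ AddSubgroup.closure {z | ∃ a, ∃ y ∈ t, z = coeff R E a * y} := by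
  -- All lists short enough to be paths are admitted; the surplus elements do no harm, since only
  -- finiteness matters.
  let P : Set (List Ed) := {l | l.length < Nat.card Ed + 1}
  have hP : P.Finite := List.finite_length_lt Ed _
  let g : (V × V) × (List Ed × List Ed) → LeavittPathAlgebra R E :=
    fun p => path R E p.1.1 p.2.1 * ghostPath R E p.1.2 p.2.2
  refine ⟨g '' (Set.univ ×ˢ (P ×ˢ P)), (Set.finite_univ.prod (hP.prod hP)).image g, ?_,
    fun x => ?_⟩
  · rintro a _ ⟨p, -, rfl⟩
    exact (coeff_comm_path a _ _).mul_right (coeff_comm_ghostPath a _ _)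
  · refine (iSup_le fun n => ?_ : ⨆ n, component R E n ≤ _) (mem_iSup_component x)
    refine (AddSubgroup.closure_le _).2 ?_
    rintro _ ⟨a, u, u', w, α, β, hα, hβ, -, rfl⟩
    exact AddSubgroup.subset_closure ⟨a, _, ⟨((u, u'), (α, β)), ⟨trivial,
      Nat.lt_succ_of_le (h.length_le hα), Nat.lt_succ_of_le (h.length_le hβ)⟩, rfl⟩, rfl⟩

theorem finite_support_of_isAcyclic [Finite Ed] (h : E.IsAcyclic) : (support R E).Finite := by
  refine (Set.finite_Icc (-(Nat.card Ed : ℤ)) (Nat.card Ed)).subset fun n hn => ?_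
  by_contra hn'
  refine hn (AddSubgroup.closure_eq_bot_iff.2 ?_)
  rintro _ ⟨a, u, u', w, α, β, hα, hβ, rfl, rfl⟩
  have h₁ := h.length_le hα
  have h₂ := h.length_le hβ
  exact absurd (Set.mem_Icc.2 ⟨by omega, by omega⟩) hn'

end LeavittPathAlgebra

/-- A ring that is finitely generated as a left module over a left artinian ring is left artinian,
and so are its subrings that contain the coefficients. -/
theorem isArtinianRing_subring_of_finite {A S : Type*} [Ring A] [Ring S] [IsArtinianRing A]
    (φ : A →+* S) {t : Set S} (ht : t.Finite)
    (hspan : ∀ x, x ∈ AddSubgroup.closure {z | ∃ a, ∃ y ∈ t, z = φ a * y})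
    (B : Subring S) (hB : ∀ a, φ a ∈ B) : IsArtinianRing B := by
  let φB : A →+* B := φ.codRestrict B hB
  let _ : Module A S := Module.compHom S φ
  let _ : Module A B := Module.compHom B φB
  have : Module.Finite A S := by
    refine ⟨Submodule.fg_def.2 ⟨t, ht, ?_⟩⟩
    refine eq_top_iff.2 fun x _ => ?_
    refine (AddSubgroup.closure_le (Submodule.span A t).toAddSubgroup).2 ?_ (hspan x)
    rintro _ ⟨a, y, hy, rfl⟩
    exact Submodule.smul_mem _ a (Submodule.subset_span hy)
  have : IsScalarTower A B B := ⟨fun a x y => mul_assoc (φB a) x y⟩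
  let ι : B →ₗ[A] S :=
    { toFun := Subtype.val, map_add' := fun _ _ => rfl, map_smul' := fun _ _ => rfl }
  have : IsArtinian A S := isArtinian_of_fg_of_artinian'
  -- `B` is artinian over `A` as a submodule of `S`, and its left ideals are `A`-submodules.
  exact isArtinian_of_tower A (isArtinian_of_injective ι Subtype.val_injective)

/-! ### The operators on infinite paths and their relations. -/

namespace LeavittPathAlgebra

open MulOpposite

open scoped Classical in
/-- The linear map that sends each basis vector satisfying `P` to another basis vector, and the
other basis vectors to zero. -/
noncomputable def partialShift (R : Type*) {I : Type*} [Ring R] (P : I → Prop)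
    (g : ∀ i, P i → I) : Module.End R (I →₀ R) :=
  Finsupp.linearCombination R fun i => if h : P i then Finsupp.single (g i h) 1 else 0

theorem partialShift_single_of_pos {R I : Type*} [Ring R] {P : I → Prop} {g : ∀ i, P i → I}
    {i : I} (h : P i) (a : R) :
    partialShift R P g (Finsupp.single i a) = Finsupp.single (g i h) a := by
  simp [partialShift, h]

theorem partialShift_single_of_neg {R I : Type*} [Ring R] {P : I → Prop} {g : ∀ i, P i → I}
    {i : I} (h : ¬ P i) (a : R) : partialShift R P g (Finsupp.single i a) = 0 := by
  simp [partialShift, h]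

section Representation

variable {R V Ed : Type*} [Ring R] {E : DirectedGraph V Ed}

variable (R E) in
/-- The free module on the infinite paths, with a basis vector for each degree. -/
abbrev InfinitePathModule : Type _ := (E.InfinitePath × ℤ) →₀ R

variable (R E) in
/-- A vertex as an operator. -/
noncomputable def vertexOp (v : V) : Module.End R (InfinitePathModule R E) :=
  partialShift R (fun p => p.1.source = v) fun p _ => p

variable (R E) in
/-- A real edge as an operator: it is put in front of an infinite path. -/
noncomputable def edgeOp (f : Ed) : Module.End R (InfinitePathModule R E) :=
  partialShift R (fun p => p.1.source = E.r f) fun p h => (p.1.cons f h, p.2 + 1)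

variable (R E) in
/-- A ghost edge as an operator: it removes the first edge of an infinite path. -/
noncomputable def ghostOp (f : Ed) : Module.End R (InfinitePathModule R E) :=
  partialShift R (fun p => p.1.1 0 = f) fun p _ => (p.1.tail, p.2 - 1)

theorem vertexOp_single_self (x : E.InfinitePath) (k : ℤ) (a : R) :
    vertexOp R E x.source (Finsupp.single (x, k) a) = Finsupp.single (x, k) a :=
  partialShift_single_of_pos (P := fun p : E.InfinitePath × ℤ => p.1.source = x.source)
    (i := (x, k)) (Eq.refl _) a

theorem vertexOp_single_of_ne {v : V} {x : E.InfinitePath} (h : x.source ≠ v) (k : ℤ) (a : R) :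
    vertexOp R E v (Finsupp.single (x, k) a) = 0 :=
  partialShift_single_of_neg (i := (x, k)) h a

theorem edgeOp_single {f : Ed} {x : E.InfinitePath} (h : x.source = E.r f) (k : ℤ) (a : R) :
    edgeOp R E f (Finsupp.single (x, k) a) = Finsupp.single (x.cons f h, k + 1) a :=
  partialShift_single_of_pos (i := (x, k)) h a

theorem edgeOp_single_of_ne {f : Ed} {x : E.InfinitePath} (h : x.source ≠ E.r f) (k : ℤ) (a : R) :
    edgeOp R E f (Finsupp.single (x, k) a) = 0 :=
  partialShift_single_of_neg (i := (x, k)) h a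

theorem ghostOp_single (x : E.InfinitePath) (k : ℤ) (a : R) :
    ghostOp R E (x.1 0) (Finsupp.single (x, k) a) = Finsupp.single (x.tail, k - 1) a :=
  partialShift_single_of_pos (P := fun p : E.InfinitePath × ℤ => p.1.1 0 = x.1 0)
    (i := (x, k)) (Eq.refl _) a

theorem ghostOp_single_of_ne {f : Ed} {x : E.InfinitePath} (h : x.1 0 ≠ f) (k : ℤ) (a : R) :
    ghostOp R E f (Finsupp.single (x, k) a) = 0 :=
  partialShift_single_of_neg (i := (x, k)) h a

theorem end_ext {A B : Module.End R (InfinitePathModule R E)}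
    (h : ∀ x k a, A (Finsupp.single (x, k) a) = B (Finsupp.single (x, k) a)) : A = B :=
  Finsupp.lhom_ext fun p a => h p.1 p.2 a

theorem vertexOp_mul_self (v : V) : vertexOp R E v * vertexOp R E v = vertexOp R E v := by
  refine end_ext fun x k a => ?_
  rw [Module.End.mul_apply]
  by_cases h : x.source = v
  · subst h; simp only [vertexOp_single_self]
  · simp only [vertexOp_single_of_ne h, map_zero]

theorem vertexOp_mul_of_ne {v w : V} (hvw : v ≠ w) : vertexOp R E v * vertexOp R E w = 0 := by
  refine end_ext fun x k a => ?_
  rw [Module.End.mul_apply]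
  by_cases h : x.source = w
  · subst h; rw [vertexOp_single_self, vertexOp_single_of_ne hvw.symm]; rfl
  · rw [vertexOp_single_of_ne h, map_zero]; rfl

theorem vertexOp_mul_edgeOp (f : Ed) : vertexOp R E (E.s f) * edgeOp R E f = edgeOp R E f := by
  refine end_ext fun x k a => ?_
  rw [Module.End.mul_apply]
  by_cases h : x.source = E.r f
  · rw [edgeOp_single h]; exact vertexOp_single_self (x.cons f h) _ _
  · rw [edgeOp_single_of_ne h, map_zero]

theorem edgeOp_mul_vertexOp (f : Ed) : edgeOp R E f * vertexOp R E (E.r f) = edgeOp R E f := by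
  refine end_ext fun x k a => ?_
  rw [Module.End.mul_apply]
  by_cases h : x.source = E.r f
  · rw [← h, vertexOp_single_self]
  · rw [vertexOp_single_of_ne h, edgeOp_single_of_ne h, map_zero]

theorem vertexOp_mul_ghostOp (f : Ed) :
    vertexOp R E (E.r f) * ghostOp R E f = ghostOp R E f := by
  refine end_ext fun x k a => ?_
  rw [Module.End.mul_apply]
  by_cases h : x.1 0 = f
  · subst h; rw [ghostOp_single, ← x.source_tail, vertexOp_single_self]
  · rw [ghostOp_single_of_ne h, map_zero]

theorem ghostOp_mul_vertexOp (f : Ed) :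
    ghostOp R E f * vertexOp R E (E.s f) = ghostOp R E f := by
  refine end_ext fun x k a => ?_
  rw [Module.End.mul_apply]
  by_cases h : x.source = E.s f
  · rw [← h, vertexOp_single_self]
  · rw [vertexOp_single_of_ne h, map_zero,
      ghostOp_single_of_ne fun h' => h (congrArg E.s h')]

theorem ghostOp_mul_edgeOp_self (f : Ed) :
    ghostOp R E f * edgeOp R E f = vertexOp R E (E.r f) := by
  refine end_ext fun x k a => ?_
  rw [Module.End.mul_apply]
  by_cases h : x.source = E.r f
  · rw [edgeOp_single h, ← h, vertexOp_single_self]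
    refine (ghostOp_single (x.cons f h) _ _).trans ?_
    rw [x.tail_cons, add_sub_cancel_right]
  · rw [edgeOp_single_of_ne h, vertexOp_single_of_ne h, map_zero]

theorem ghostOp_mul_edgeOp_of_ne {f g : Ed} (hfg : f ≠ g) :
    ghostOp R E f * edgeOp R E g = 0 := by
  refine end_ext fun x k a => ?_
  rw [Module.End.mul_apply]
  by_cases h : x.source = E.r g
  · rw [edgeOp_single h]; exact ghostOp_single_of_ne (x := x.cons g h) hfg.symm _ _
  · rw [edgeOp_single_of_ne h, map_zero]; rfl

theorem edgeOp_ghostOp_single (x : E.InfinitePath) (k : ℤ) (a : R) :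
    edgeOp R E (x.1 0) (ghostOp R E (x.1 0) (Finsupp.single (x, k) a)) =
      Finsupp.single (x, k) a := by
  rw [ghostOp_single, edgeOp_single x.source_tail, x.cons_tail, sub_add_cancel]

/-- An infinite path from `v` has exactly one first edge, so one summand restores it and the others
kill it. -/
theorem sum_edgeOp_mul_ghostOp (v : V) (S : Finset Ed) (hS : ∀ f, f ∈ S ↔ E.s f = v) :
    ∑ f ∈ S, edgeOp R E f * ghostOp R E f = vertexOp R E v := by
  refine end_ext fun x k a => ?_
  rw [LinearMap.sum_apply]
  by_cases h : x.source = v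
  · rw [Finset.sum_eq_single_of_mem (x.1 0) ((hS _).2 h), ← h, vertexOp_single_self,
      Module.End.mul_apply, edgeOp_ghostOp_single]
    intro f _ hf
    rw [Module.End.mul_apply, ghostOp_single_of_ne hf.symm, map_zero]
  · rw [vertexOp_single_of_ne h]
    refine Finset.sum_eq_zero fun f hf => ?_
    rw [Module.End.mul_apply, ghostOp_single_of_ne, map_zero]
    rintro rfl
    exact h ((hS _).1 hf)

theorem sum_vertexOp [Fintype V] : ∑ v, vertexOp R E v = 1 := by
  refine end_ext fun x k a => ?_
  rw [LinearMap.sum_apply, Finset.sum_eq_single_of_mem x.source (Finset.mem_univ _),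
    vertexOp_single_self]
  · rfl
  · exact fun v _ hv => vertexOp_single_of_ne hv.symm _ _

variable (R E) in
/-- Linear operators as additive operators. -/
noncomputable def toAddEnd :
    Module.End R (InfinitePathModule R E) →+* AddMonoid.End (InfinitePathModule R E) :=
  Module.toAddMonoidEnd _ _

/-- This is the linearity of `A`. Scalars themselves need not act linearly over a noncommutative
`R`, whence the passage to additive endomorphisms. -/
theorem commute_toAddEnd (a : R) (A : Module.End R (InfinitePathModule R E)) :
    Commute (Module.toAddMonoidEnd R (InfinitePathModule R E) a) (toAddEnd R E A) :=
  AddMonoidHom.ext fun y => (A.map_smul a y).symm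

/-! ### The translation of degrees. -/

variable (R E) in
/-- The change of degree by `k`. -/
noncomputable def degreeShift (k : ℤ) : Module.End R (InfinitePathModule R E) :=
  Finsupp.lmapDomain R R fun p => (p.1, p.2 + k)

theorem degreeShift_single (k l : ℤ) (x : E.InfinitePath) (a : R) :
    degreeShift R E k (Finsupp.single (x, l) a) = Finsupp.single (x, l + k) a :=
  Finsupp.mapDomain_single

theorem degreeShift_apply (k l : ℤ) (x : E.InfinitePath) (y : InfinitePathModule R E) :
    degreeShift R E k y (x, l + k) = y (x, l) :=
  Finsupp.mapDomain_apply (f := fun p : E.InfinitePath × ℤ => (p.1, p.2 + k))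
    (fun p q h => by simpa [Prod.ext_iff] using h) y (x, l)

/-- A nonzero element of finite support is not invariant under a change of degree. -/
theorem injective_one_sub_degreeShift {k : ℤ} (hk : k ≠ 0) :
    Function.Injective (1 - degreeShift R E k : Module.End R (InfinitePathModule R E)) := by
  rw [← LinearMap.ker_eq_bot, LinearMap.ker_eq_bot']
  intro y hy
  replace hy : degreeShift R E k y = y := (sub_eq_zero.1 hy).symm
  by_contra hne
  obtain ⟨⟨x, l⟩, hl⟩ := Finsupp.ne_iff.1 hne
  -- Invariance propagates a nonzero coefficient along an arithmetic progression, which is infinite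
  -- as `k ≠ 0`.
  have key (n : ℕ) : y (x, l + n * k) = y (x, l) := by
    induction n with
    | zero => simp
    | succ n ih =>
      rw [← ih, ← degreeShift_apply k (l + n * k), hy]
      congr 2
      push_cast
      ring
  refine (Set.infinite_of_injective_forall_mem (f := fun n : ℕ => (x, l + n * k))
    (fun m n h => by simpa [hk] using h) fun n => ?_) y.support.finite_toSet
  rw [Finset.mem_coe, Finsupp.mem_support_iff, key]
  exact hl

/-- The sum of all coefficients is unchanged by a translation, so it vanishes on the range, but it
is `1` on the basis vector. -/
theorem single_notMem_range_one_sub_degreeShift [Nontrivial R] (k : ℤ) (x : E.InfinitePath)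
    (y : InfinitePathModule R E) :
    (1 - degreeShift R E k : Module.End R (InfinitePathModule R E)) y ≠ Finsupp.single (x, 0) 1 := by
  intro h
  have h' := congrArg (Finsupp.linearCombination R fun _ => (1 : R)) h
  rw [LinearMap.sub_apply, map_sub, degreeShift, Finsupp.lmapDomain_apply,
    Finsupp.linearCombination_mapDomain] at h'
  simp [Function.comp_def] at h'

/-! ### The representation, and what a cycle implies. -/

variable [Fintype V]

variable (R E) in
/-- The action of the Leavitt path algebra on the infinite paths. -/
noncomputable def infinitePathFamily : Family R E (AddMonoid.End (InfinitePathModule R E)) where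
  coeff := Module.toAddMonoidEnd R (InfinitePathModule R E)
  vertex v := toAddEnd R E (vertexOp R E v)
  edge f := toAddEnd R E (edgeOp R E f)
  ghost f := toAddEnd R E (ghostOp R E f)
  commute_vertex a v := commute_toAddEnd a _
  commute_edge a v := commute_toAddEnd a _
  commute_ghost a v := commute_toAddEnd a _
  vertex_mul_self v := by rw [← map_mul, vertexOp_mul_self]
  vertex_mul_of_ne h := by rw [← map_mul, vertexOp_mul_of_ne h, map_zero]
  source_mul_edge f := by rw [← map_mul, vertexOp_mul_edgeOp]
  edge_mul_range f := by rw [← map_mul, edgeOp_mul_vertexOp]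
  range_mul_ghost f := by rw [← map_mul, vertexOp_mul_ghostOp]
  ghost_mul_source f := by rw [← map_mul, ghostOp_mul_vertexOp]
  ghost_mul_edge_self f := by rw [← map_mul, ghostOp_mul_edgeOp_self]
  ghost_mul_edge_of_ne h := by rw [← map_mul, ghostOp_mul_edgeOp_of_ne h, map_zero]
  sum_edge_mul_ghost v S hS _ := by
    simp only [← map_mul, ← map_sum, sum_edgeOp_mul_ghostOp v S hS]
  sum_vertex := by rw [← map_sum, sum_vertexOp, map_one]

variable (R E) in
/-- The representation of the Leavitt path algebra on the infinite paths. -/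
noncomputable def infinitePathRep :
    LeavittPathAlgebra R E →+* AddMonoid.End (InfinitePathModule R E) :=
  (infinitePathFamily R E).lift

/-- The ghost of the initial path of an infinite path removes this initial path. -/
theorem infinitePathRep_ghostPath_take (x : E.InfinitePath) (n : ℕ) (k : ℤ) (a : R) :
    infinitePathRep R E (ghostPath R E x.source (x.take n)) (Finsupp.single (x, k) a) =
      Finsupp.single (DirectedGraph.InfinitePath.tail^[n] x, k - n) a := by
  induction n generalizing x k with
  | zero =>
    rw [DirectedGraph.InfinitePath.take, ghostPath_nil, infinitePathRep, Family.lift_vertex]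
    refine (vertexOp_single_self x k a).trans ?_
    simp
  | succ n ih =>
    rw [DirectedGraph.InfinitePath.take, DirectedGraph.InfinitePath.source, ghostPath_cons,
      map_mul, ← x.source_tail, Function.iterate_succ_apply]
    have h : infinitePathRep R E (ghost R E (x.1 0)) (Finsupp.single (x, k) a) =
        Finsupp.single (x.tail, k - 1) a := by
      rw [infinitePathRep, Family.lift_ghost]
      exact ghostOp_single x k a
    refine (congrArg _ h).trans ((ih x.tail (k - 1)).trans ?_)
    congr 2
    push_cast
    ring

theorem infinite_support_of_not_isAcyclic [Nontrivial R] (h : ¬ E.IsAcyclic) :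
    (support R E).Infinite := by
  obtain ⟨x, -⟩ := DirectedGraph.exists_periodic_infinitePath h
  refine Set.infinite_of_injective_forall_mem (f := fun n : ℕ => -(n : ℤ))
    (fun m n h => by simpa using h) fun n hn => ?_
  have hmem : ghostPath R E x.source (x.take n) ∈ component R E (-(n : ℤ)) := by
    refine AddSubgroup.subset_closure ⟨1, _, x.source, _, [], x.take n, rfl, x.isPath_take n,
      by simp [x.length_take], ?_⟩
    have := ghostPath_mul_ghostPath (R := R) (x.isPath_take n) []
    rw [List.append_nil, ghostPath_nil] at this
    rw [coeff_one, one_mul, path_nil, this]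
  rw [hn, AddSubgroup.mem_bot] at hmem
  have := infinitePathRep_ghostPath_take (R := R) x n 0 1
  rw [hmem, map_zero] at this
  exact one_ne_zero (Finsupp.single_eq_zero.1 this.symm)

/-- Generators change the degree by a constant, and whether they kill a basis vector does not depend
on its degree. -/
theorem commute_degreeShift (k : ℤ) (z : LeavittPathAlgebra R E) :
    Commute (infinitePathRep R E z) (toAddEnd R E (degreeShift R E k)) := by
  induction z using LeavittPathAlgebra.induction with
  | hc a =>
    rw [infinitePathRep, Family.lift_coeff]
    exact commute_toAddEnd a _
  | hv v =>
    rw [infinitePathRep, Family.lift_vertex]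
    refine Commute.map (f := toAddEnd R E) (end_ext fun x l a => ?_)
    simp only [Module.End.mul_apply, degreeShift_single]
    by_cases h : x.source = v
    · subst h; simp only [vertexOp_single_self, degreeShift_single]
    · simp only [vertexOp_single_of_ne h, map_zero]
  | he f =>
    rw [infinitePathRep, Family.lift_edge]
    refine Commute.map (f := toAddEnd R E) (end_ext fun x l a => ?_)
    simp only [Module.End.mul_apply, degreeShift_single]
    by_cases h : x.source = E.r f
    · simp only [edgeOp_single h, degreeShift_single, add_right_comm]
    · simp only [edgeOp_single_of_ne h, map_zero]
  | hg f =>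
    rw [infinitePathRep, Family.lift_ghost]
    refine Commute.map (f := toAddEnd R E) (end_ext fun x l a => ?_)
    simp only [Module.End.mul_apply, degreeShift_single]
    by_cases h : x.1 0 = f
    · subst h; simp only [ghostOp_single, degreeShift_single, sub_add_eq_add_sub]
    · simp only [ghostOp_single_of_ne h, map_zero]
  | hadd y z hy hz => rw [map_add]; exact hy.add_left hz
  | hmul y z hy hz => rw [map_mul]; exact hy.mul_left hz

/-- A left artinian Leavitt path algebra has an acyclic graph. -/
theorem isAcyclic_of_isArtinianRing [Nontrivial R] [IsArtinianRing (LeavittPathAlgebra R E)] :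
    E.IsAcyclic := by
  by_contra h
  obtain ⟨x, m, hm, hx⟩ := DirectedGraph.exists_periodic_infinitePath h
  let p : LeavittPathAlgebra R E := 1 - ghostPath R E x.source (x.take m)
  let e : InfinitePathModule R E := Finsupp.single (x, 0) 1
  let D : Module.End R (InfinitePathModule R E) := 1 - degreeShift R E (-m)
  let ρ := infinitePathRep R E
  have hmul (A B : AddMonoid.End (InfinitePathModule R E)) (y) : (A * B) y = A (B y) := rfl
  have hD (z : LeavittPathAlgebra R E) : Commute (ρ z) (toAddEnd R E D) := by
    have h : toAddEnd R E D = 1 - toAddEnd R E (degreeShift R E (-m)) := rfl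
    rw [h]
    exact Commute.sub_right (R := AddMonoid.End (InfinitePathModule R E)) (Commute.one_right _)
      (commute_degreeShift (-m) z)
  -- Removing `m` edges, a full period, returns `x` itself with the degree lowered by `m`.
  have hp : ρ p e = toAddEnd R E D e := by
    have h₁ : ρ p = 1 - ρ (ghostPath R E x.source (x.take m)) := by simp only [p, map_sub, map_one]
    have h₂ := infinitePathRep_ghostPath_take (R := R) x m 0 1
    rw [hx, sub_eq_add_neg, ← degreeShift_single] at h₂
    rw [h₁]
    exact congrArg (e - ·) h₂
  -- The two operators are compared only at `e`; powers follow because `D` can be moved past `ρ p`.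
  have hpow (n : ℕ) : (ρ p ^ n) e = (toAddEnd R E D ^ n) e := by
    induction n with
    | zero => rfl
    | succ n ih =>
      rw [pow_succ, hmul, hp, ← hmul,
        ((hD p).pow_left n).eq, hmul, ih, ← hmul, ← pow_succ']
  let I : ℕ →o (Submodule (LeavittPathAlgebra R E) (LeavittPathAlgebra R E))ᵒᵈ :=
    ⟨fun n => OrderDual.toDual (Submodule.span _ {p ^ n}), monotone_nat_of_le_succ fun n =>
      OrderDual.toDual_le_toDual.2 ((Submodule.span_singleton_le_iff_mem _ _).2
        (Submodule.mem_span_singleton.2 ⟨p, (pow_succ' p n).symm⟩))⟩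
  obtain ⟨n, hn⟩ := IsArtinian.monotone_stabilizes I
  have hmem : p ^ n ∈ Submodule.span (LeavittPathAlgebra R E) {p ^ (n + 1)} := by
    have h₀ : Submodule.span (LeavittPathAlgebra R E) {p ^ n} = Submodule.span _ {p ^ (n + 1)} :=
      congrArg OrderDual.ofDual (hn (n + 1) n.le_succ)
    rw [← h₀]
    exact Submodule.mem_span_singleton_self _
  obtain ⟨z, hz⟩ := Submodule.mem_span_singleton.1 hmem
  -- The relation `z pⁿ⁺¹ = pⁿ` applied to `e`, with `z` moved inside the powers of `D`.
  have h₁ : (toAddEnd R E D ^ n) (toAddEnd R E D (ρ z e)) = (toAddEnd R E D ^ n) e := by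
    rw [← hpow n, ← map_pow ρ, ← hz, smul_eq_mul, map_mul, map_pow, hmul, hpow,
      ← hmul, ← hmul, ← pow_succ,
      ← ((hD z).pow_right (n + 1)).eq, hmul]
  rw [← map_pow (toAddEnd R E)] at h₁
  have hinj : Function.Injective (D ^ n) := by
    rw [Module.End.coe_pow]
    exact (injective_one_sub_degreeShift (by omega)).iterate n
  exact single_notMem_range_one_sub_degreeShift _ x _ (hinj h₁)

end Representation

/-! ### The involution and the right-hand versions. -/

variable {R V Ed : Type*} [Ring R] [Fintype V] {E : DirectedGraph V Ed}

variable (R E) in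
/-- The involution of the Leavitt path algebra exchanges real and ghost edges. -/
noncomputable def starFamily : Family R E (LeavittPathAlgebra Rᵐᵒᵖ E)ᵐᵒᵖ where
  -- Reversing products also reverses those of coefficients, so `a` goes to `op (coeff (op a))` over
  -- `Rᵐᵒᵖ`.
  coeff := (RingHom.op (coeffHom Rᵐᵒᵖ E)).comp (RingEquiv.opOp R).toRingHom
  vertex v := op (LeavittPathAlgebra.vertex Rᵐᵒᵖ E v)
  edge f := op (LeavittPathAlgebra.ghost Rᵐᵒᵖ E f)
  ghost f := op (LeavittPathAlgebra.edge Rᵐᵒᵖ E f)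
  commute_vertex a v := (coeff_comm_of (R := Rᵐᵒᵖ) (E := E) (op a) _).op
  commute_edge a v := (coeff_comm_of (R := Rᵐᵒᵖ) (E := E) (op a) _).op
  commute_ghost a v := (coeff_comm_of (R := Rᵐᵒᵖ) (E := E) (op a) _).op
  vertex_mul_self v := congrArg op (LeavittPathAlgebra.vertex_mul_self v)
  vertex_mul_of_ne h := congrArg op (LeavittPathAlgebra.vertex_mul_of_ne h.symm)
  source_mul_edge f := congrArg op (LeavittPathAlgebra.ghost_mul_source f)
  edge_mul_range f := congrArg op (LeavittPathAlgebra.range_mul_ghost f)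
  range_mul_ghost f := congrArg op (LeavittPathAlgebra.edge_mul_range f)
  ghost_mul_source f := congrArg op (LeavittPathAlgebra.source_mul_edge f)
  ghost_mul_edge_self f := congrArg op (LeavittPathAlgebra.ghost_mul_edge_self f)
  ghost_mul_edge_of_ne h := congrArg op (LeavittPathAlgebra.ghost_mul_edge_of_ne h.symm)
  sum_edge_mul_ghost v S hS hne := by
    simp only [← op_mul, ← Finset.op_sum, LeavittPathAlgebra.sum_edge_mul_ghost v S hS hne]
  sum_vertex := by rw [← Finset.op_sum, LeavittPathAlgebra.sum_vertex, op_one]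

/-- Surjectivity suffices to transfer the artinian property, which passes to quotient rings. -/
theorem starFamily_lift_surjective : Function.Surjective (starFamily R E).lift := by
  suffices ∀ y : LeavittPathAlgebra Rᵐᵒᵖ E, ∃ x, (starFamily R E).lift x = op y from
    fun y => this y.unop
  intro y
  induction y using LeavittPathAlgebra.induction with
  | hc a => exact ⟨_, (starFamily R E).lift_coeff a.unop⟩
  | hv v => exact ⟨_, (starFamily R E).lift_vertex v⟩
  | he f => exact ⟨_, (starFamily R E).lift_ghost f⟩
  | hg f => exact ⟨_, (starFamily R E).lift_edge f⟩
  | hadd y z hy hz =>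
    obtain ⟨y', hy⟩ := hy
    obtain ⟨z', hz⟩ := hz
    exact ⟨y' + z', by rw [map_add, hy, hz, op_add]⟩
  | hmul y z hy hz =>
    obtain ⟨y', hy⟩ := hy
    obtain ⟨z', hz⟩ := hz
    exact ⟨z' * y', by rw [map_mul, hy, hz, op_mul]⟩

/-- A right artinian Leavitt path algebra has an acyclic graph. -/
theorem isAcyclic_of_isArtinianRing_op [Nontrivial R]
    [IsArtinianRing (LeavittPathAlgebra R E)ᵐᵒᵖ] : E.IsAcyclic := by
  let φ := (RingEquiv.opOp (LeavittPathAlgebra Rᵐᵒᵖ E)).symm.toRingHom.comp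
    (RingHom.op (starFamily R E).lift)
  have hφ : Function.Surjective φ := fun y => by
    obtain ⟨x, hx⟩ := starFamily_lift_surjective (R := R) (E := E) (op y)
    exact ⟨op x, congrArg unop hx⟩
  have : IsArtinianRing (LeavittPathAlgebra Rᵐᵒᵖ E) := hφ.isArtinianRing
  exact isAcyclic_of_isArtinianRing (R := Rᵐᵒᵖ)

theorem coeff_mem_principalComponent (a : R) : coeff R E a ∈ principalComponent R E := by
  change coeff R E a ∈ component R E 0
  rw [← mul_one (coeff R E a), ← sum_vertex, Finset.mul_sum]
  refine sum_mem fun v _ => AddSubgroup.subset_closure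
    ⟨a, v, v, v, [], [], rfl, rfl, by simp, ?_⟩
  rw [path_nil, ghostPath_nil, vertex_mul_self]

/-- A general subring `B` covers both the principal component and, with `B = ⊤`, the whole algebra.
-/
theorem isArtinianRing_subring_of_isAcyclic [Finite Ed] [IsArtinianRing R] (h : E.IsAcyclic)
    (B : Subring (LeavittPathAlgebra R E)) (hB : ∀ a, coeff R E a ∈ B) : IsArtinianRing B := by
  obtain ⟨t, ht, -, hspan⟩ := exists_finite_generators (R := R) h
  exact isArtinianRing_subring_of_finite (coeffHom R E) ht hspan B hB

/-- The spanning monomials commute with the coefficients, so they also span with the coefficients on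
the right. -/
theorem isArtinianRing_subring_op_of_isAcyclic [Finite Ed] [IsArtinianRing Rᵐᵒᵖ]
    (h : E.IsAcyclic) (B : Subring (LeavittPathAlgebra R E)) (hB : ∀ a, coeff R E a ∈ B) :
    IsArtinianRing Bᵐᵒᵖ := by
  obtain ⟨t, ht, hcomm, hspan⟩ := exists_finite_generators (R := R) h
  have : IsArtinianRing B.op := by
    refine isArtinianRing_subring_of_finite (RingHom.op (coeffHom R E)) (ht.image op)
      (fun x => ?_) B.op fun a => hB a.unop
    let C := AddSubgroup.closure {z | ∃ a, ∃ y ∈ op '' t, z = RingHom.op (coeffHom R E) a * y}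
    have hC : AddSubgroup.closure {z | ∃ a, ∃ y ∈ t, z = coeff R E a * y} ≤
        C.comap (opAddEquiv : LeavittPathAlgebra R E ≃+ _).toAddMonoidHom := by
      refine (AddSubgroup.closure_le _).2 ?_
      rintro _ ⟨a, y, hy, rfl⟩
      exact AddSubgroup.subset_closure
        ⟨op a, op y, ⟨y, hy, rfl⟩, congrArg op (hcomm a y hy).eq⟩
    exact hC (hspan x.unop)
  exact (Subring.mopRingEquivOp B).symm.surjective.isArtinianRing

end LeavittPathAlgebra

theorem mainTheorem6 {R V Ed : Type*} [Ring R] [Nontrivial R] [Fintype V] [Finite Ed]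
    (E : DirectedGraph V Ed) :
    -- the left version
    (IsArtinianRing R →
      List.TFAE [
        E.IsAcyclic,
        IsArtinianRing (LeavittPathAlgebra.principalComponent R E) ∧
          (LeavittPathAlgebra.support R E).Finite,
        IsArtinianRing (LeavittPathAlgebra R E)]) ∧
    -- the right version
    (IsArtinianRing Rᵐᵒᵖ →
      List.TFAE [
        E.IsAcyclic,
        IsArtinianRing (LeavittPathAlgebra.principalComponent R E)ᵐᵒᵖ ∧
          (LeavittPathAlgebra.support R E).Finite,
        IsArtinianRing (LeavittPathAlgebra R E)ᵐᵒᵖ]) := by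
  have hsupp (h : (LeavittPathAlgebra.support R E).Finite) : E.IsAcyclic := by
    by_contra h'
    exact LeavittPathAlgebra.infinite_support_of_not_isAcyclic h' h
  refine ⟨fun _ => ?_, fun _ => ?_⟩
  · tfae_have 1 → 2 := fun h =>
      ⟨LeavittPathAlgebra.isArtinianRing_subring_of_isAcyclic h _
        LeavittPathAlgebra.coeff_mem_principalComponent,
        LeavittPathAlgebra.finite_support_of_isAcyclic h⟩
    tfae_have 2 → 1 := fun h => hsupp h.2
    tfae_have 1 → 3 := fun h => by
      have := LeavittPathAlgebra.isArtinianRing_subring_of_isAcyclic (R := R) h ⊤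
        fun _ => trivial
      exact (Subring.topEquiv (R := LeavittPathAlgebra R E)).surjective.isArtinianRing
    tfae_have 3 → 1 := fun _ => LeavittPathAlgebra.isAcyclic_of_isArtinianRing (R := R)
    tfae_finish
  · tfae_have 1 → 2 := fun h =>
      ⟨LeavittPathAlgebra.isArtinianRing_subring_op_of_isAcyclic h _
        LeavittPathAlgebra.coeff_mem_principalComponent,
        LeavittPathAlgebra.finite_support_of_isAcyclic h⟩
    tfae_have 2 → 1 := fun h => hsupp h.2
    tfae_have 1 → 3 := fun h => by
      have := LeavittPathAlgebra.isArtinianRing_subring_op_of_isAcyclic (R := R) h ⊤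
        fun _ => trivial
      exact (RingEquiv.op
        (Subring.topEquiv (R := LeavittPathAlgebra R E))).surjective.isArtinianRing
    tfae_have 3 → 1 := fun _ => LeavittPathAlgebra.isAcyclic_of_isArtinianRing_op (R := R)
    tfae_finish
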